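/- Let $\mathbb F$ be a field of characteristic $0$ and let $p=(p_1\ge p_2\ge\dots\ge p_r>0)$, $r\ge1$, be a partition of $N$. Let $r_1$ be the multiplicity of $p_1$ in $p$, and index a basis $e_{(ih)}$ of $\mathbb F^N$ by the pairs $(i,h)$ with $1\le i\le r$, $1\le h\le p_i$. Let $\mathfrak g=\mathfrak{gl}_N$, with elementary matrices $E_{(ih),(jk)}$. Let $f\in\mathfrak g$ be the nilpotent element with $f e_{(ih)}=e_{(i,h+1)}$ for $h<p_i$ and $f e_{(ip_i)}=0$, let $x\in\mathfrak g$ be the diagonal matrix with eigenvalue $\frac12(p_i+1-2h)$ on $e_{(ih)}$, and let $\mathfrak g_k=\{a\in\mathfrak g: [x,a]=ka\}$, so that $\mathfrak g=\bigoplus_{k\in\frac12\mathbb Z}\mathfrak g_k$. Put $d=p_1-1$, $\mathfrak g_{\ge\frac12}=\bigoplus_{k\ge\frac12}\mathfrak g_k$ and $\mathfrak g_{\le\frac12}=\bigoplus_{k\le\frac12}\mathfrak g_k$. For a subspace $\mathfrak a\subset\mathfrak g$ let $\mathcal V(\mathfrak a)=S(\mathbb F[\partial]\mathfrak a)$ be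 the algebra of differential polynomials over $\mathfrak a$. For $S\in\mathfrak g_d$ and $\epsilon\in\mathbb F$ let $\{\cdot\,_\lambda\,\cdot\}_\epsilon$ be the $\lambda$-bracket on $\mathcal V(\mathfrak g)$ given on generators $a,b\in\mathfrak g$ by $$\{a_\lambda b\}_\epsilon=[a,b]+\mathrm{tr}(ab)\lambda+\epsilon\,\mathrm{tr}(S[a,b])$$ and extended by sesquilinearity and the Leibniz rules. Let $\rho:\mathcal V(\mathfrak g)\to\mathcal V(\mathfrak g_{\le\frac12})$ be the differential algebra homomorphism with $\rho(a)=\pi_{\le\frac12}(a)+\mathrm{tr}(fa)$ for $a\in\mathfrak g$, where $\pi_{\le\frac12}$ is the projection onto $\mathfrak g_{\le\frac12}$ with kernel $\bigoplus_{k\ge1}\mathfrak g_k$; it is applied to polynomials in $\lambda$ coefficientwise. The algebra underlying the classical affine $W$-algebra $\mathcal W_\epsilon(\mathfrak g,f,S)$ is $$\mathcal W=\mathcal W(\mathfrak g,f)=\{w\in\mathcal V(\mathfrak g_{\le\frac12}):\ \rho\{a_\lambda w\}_\epsilon=0\ \text{ for all } a\in\mathfrak g_{\ge\frac12}\}.$$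 Let $Q$ be the $N\times N$ matrix over $\mathcal V(\mathfrak g)$ whose entry in position $(\alpha,\beta)$ is $E_{\beta\alpha}$ viewed as an element of $\mathcal V(\mathfrak g)$, and let $I_1=\sum_{i=1}^{r_1}E_{(i1),i}\in\mathrm{Mat}_{N\times r_1}\mathbb F$, $J_1=\sum_{i=1}^{r_1}E_{i,(ip_1)}\in\mathrm{Mat}_{r_1\times N}\mathbb F$. **Theorem.** The matrix $\mathbb 1_N\partial+\rho(Q)$ is invertible in the ring $\mathrm{Mat}_{N\times N}\mathcal V(\mathfrak g_{\le\frac12})((\partial^{-1}))$ of matrix pseudodifferential operators, and the operator $$L_1^{-1}(\partial)=J_1(\mathbb 1_N\partial+\rho(Q))^{-1}I_1\in\mathrm{Mat}_{r_1\times r_1}\mathcal V(\mathfrak g_{\le\frac12})((\partial^{-1}))$$ satisfies, for all $S\in\mathfrak g_d$ and $\epsilon\in\mathbb F$, $$\rho\{a_\lambda L_1^{-1}(z)_{ij}\}_\epsilon=0\quad\text{for all } i,j\in\{1,\dots,r_1\},\ a\in\mathfrak g_{\ge\frac12}$$ (the bracket being taken with each coefficient of the symbol $L_1^{-1}(z)_{ij}$).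 In particular, for all $S\in\mathfrak g_d$ and $\epsilon\in\mathbb F$, all entries of the coefficients of $L_1^{-1}(\partial)$ lie in $\mathcal W$. -/

import Mathlib

open scoped Differential
noncomputable section

/-- Two-sided sequences `a : ℤ → V` that vanish above some index: the coefficient sequences of
the formal sums `∑ aₙ ∂ⁿ` with finitely many positive powers of `∂`. -/
def pdoAddSubgroup (V : Type*) [AddCommGroup V] : AddSubgroup (ℤ → V) where
  carrier := {a | ∃ M : ℤ, ∀ n, M < n → a n = 0}
  zero_mem' := ⟨0, fun _ _ => rfl⟩
  add_mem' := by
    rintro a b ⟨M, hM⟩ ⟨L, hL⟩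
    refine ⟨max M L, fun n hn => ?_⟩
    simp [hM n (lt_of_le_of_lt (le_max_left _ _) hn), hL n (lt_of_le_of_lt (le_max_right _ _) hn)]
  neg_mem' := by
    rintro a ⟨M, hM⟩
    exact ⟨M, fun n hn => by simp [hM n hn]⟩

/-- The space `V((∂⁻¹))` of scalar pseudodifferential operators `∑_{n ≤ M} aₙ ∂ⁿ` over `V`. -/
def PDO (V : Type*) [AddCommGroup V] : Type _ := pdoAddSubgroup V

namespace PDO

section Additive
variable {V : Type*} [AddCommGroup V]

instance : AddCommGroup (PDO V) := inferInstanceAs (AddCommGroup (pdoAddSubgroup V))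

/-- The coefficient of `∂ⁿ` (coefficients are written on the left of the powers of `∂`);
equivalently the coefficient of `zⁿ` in the symbol `A(z)`. -/
def coeff (A : PDO V) (n : ℤ) : V := A.1 n

/-- `A` has order at most `M`. -/
def BddBy (A : PDO V) (M : ℤ) : Prop := ∀ n, M < n → A.coeff n = 0

theorem exists_bddBy (A : PDO V) : ∃ M, A.BddBy M := A.2

theorem ext {A B : PDO V} (h : ∀ n, A.coeff n = B.coeff n) : A = B := Subtype.ext (funext h)

@[simp] theorem coeff_zero (n : ℤ) : (0 : PDO V).coeff n = 0 := rfl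
@[simp] theorem coeff_add (A B : PDO V) (n : ℤ) : (A + B).coeff n = A.coeff n + B.coeff n := rfl
@[simp] theorem coeff_neg (A : PDO V) (n : ℤ) : (-A).coeff n = -A.coeff n := rfl
@[simp] theorem coeff_sub (A B : PDO V) (n : ℤ) : (A - B).coeff n = A.coeff n - B.coeff n := rfl

/-- The operator `a ∂ᵐ`. -/
def monomial (m : ℤ) (a : V) : PDO V :=
  ⟨fun n => if n = m then a else 0, m, fun _ hn => if_neg hn.ne'⟩

theorem coeff_monomial (m : ℤ) (a : V) (n : ℤ) :
    (monomial m a).coeff n = if n = m then a else 0 := rfl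

/-- Two additive maps that shift the order by a bounded amount agree if they agree on monomials. -/
theorem addHom_ext (f g : PDO V →+ PDO V)
    (hf : ∃ c, ∀ A K, BddBy A K → BddBy (f A) (K + c))
    (hg : ∃ c, ∀ A K, BddBy A K → BddBy (g A) (K + c))
    (h : ∀ m a, f (monomial m a) = g (monomial m a)) (A : PDO V) : f A = g A := by
  obtain ⟨c, hc⟩ := hf
  obtain ⟨d, hd⟩ := hg
  obtain ⟨M, hM⟩ := A.exists_bddBy
  refine ext fun n => ?_
  obtain ⟨K, hKc, hKd⟩ : ∃ K : ℤ, K + c < n ∧ K + d < n :=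
    ⟨min (n - c) (n - d) - 1, by omega, by omega⟩
  set T : PDO V := ∑ i ∈ Finset.Icc (K + 1) M, monomial i (A.coeff i) with hT
  have hcoeff : ∀ k, T.coeff k = ∑ i ∈ Finset.Icc (K + 1) M, (monomial i (A.coeff i)).coeff k := by
    intro k
    exact map_sum (⟨⟨fun B : PDO V => B.coeff k, rfl⟩, fun _ _ => rfl⟩ : PDO V →+ V) _ _
  have hR : BddBy (A - T) K := by
    intro k hk
    rw [coeff_sub, hcoeff]
    simp only [coeff_monomial, Finset.sum_ite_eq, Finset.mem_Icc]
    split_ifs with h1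
    · simp
    · rw [hM k (by omega)]; simp
  have hTfg : f T = g T := by
    rw [hT, map_sum, map_sum]
    exact Finset.sum_congr rfl fun i _ => h _ _
  have e : A = T + (A - T) := by abel
  rw [e, map_add, map_add, coeff_add, coeff_add, hTfg, hc _ _ hR n hKc, hd _ _ hR n hKd]

end Additive

variable {V : Type*} [CommRing V] [Differential V]

/-- The coefficient of `∂ⁿ` in `(∑ aᵢ ∂ⁱ) ∘ (∑ bⱼ ∂ʲ)`, where
`∂ⁱ ∘ b = ∑_{k ≥ 0} (i choose k) b⁽ᵏ⁾ ∂ⁱ⁻ᵏ`, so that `j = n - i + k`.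
The sum has finitely many nonzero terms (see `mulTerm_support_finite`). -/
def mulCoeff (a b : ℤ → V) (n : ℤ) : V :=
  ∑ᶠ x : ℤ × ℕ, Ring.choose x.1 x.2 •
    (a x.1 * (Differential.deriv (R := V))^[x.2] (b (n - x.1 + x.2)))

theorem D_zero (k : ℕ) : (Differential.deriv (R := V))^[k] 0 = 0 :=
  iterate_map_zero _ k

theorem mulTerm_eq_zero {a b : ℤ → V} {M L : ℤ} (ha : ∀ n, M < n → a n = 0)
    (hb : ∀ n, L < n → b n = 0) (n : ℤ) (x : ℤ × ℕ) (hx : M < x.1 ∨ L < n - x.1 + x.2) :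
    Ring.choose x.1 x.2 • (a x.1 * (Differential.deriv (R := V))^[x.2] (b (n - x.1 + x.2))) = 0 := by
  rcases hx with hx | hx
  · simp [ha _ hx]
  · simp [hb _ hx]

theorem mulTerm_support_finite {a b : ℤ → V} {M L : ℤ} (ha : ∀ n, M < n → a n = 0)
    (hb : ∀ n, L < n → b n = 0) (n : ℤ) :
    (Function.support fun x : ℤ × ℕ => Ring.choose x.1 x.2 •
      (a x.1 * (Differential.deriv (R := V))^[x.2] (b (n - x.1 + x.2)))).Finite := by
  refine ((Finset.Icc (n - L) M ×ˢ Finset.range (M + L - n + 1).toNat).finite_toSet).subset ?_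
  intro x hx
  by_contra h
  refine hx (mulTerm_eq_zero ha hb n x ?_)
  simp only [Finset.coe_product, Set.mem_prod, Finset.mem_coe, Finset.mem_Icc, Finset.mem_range] at h
  by_contra h'
  apply h
  omega

theorem mulCoeff_eq_zero {a b : ℤ → V} {M L : ℤ} (ha : ∀ n, M < n → a n = 0)
    (hb : ∀ n, L < n → b n = 0) (n : ℤ) (hn : M + L < n) : mulCoeff a b n = 0 := by
  refine finsum_eq_zero_of_forall_eq_zero fun x => mulTerm_eq_zero ha hb n x ?_
  omega

/-- Composition of pseudodifferential operators. -/
instance : Mul (PDO V) where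
  mul A B := ⟨mulCoeff A.1 B.1, by
    obtain ⟨M, hM⟩ := A.2
    obtain ⟨L, hL⟩ := B.2
    exact ⟨M + L, fun n hn => mulCoeff_eq_zero hM hL n hn⟩⟩

instance : One (PDO V) := ⟨monomial 0 1⟩

theorem coeff_mul (A B : PDO V) (n : ℤ) :
    (A * B).coeff n = ∑ᶠ x : ℤ × ℕ, Ring.choose x.1 x.2 •
      (A.coeff x.1 * (Differential.deriv (R := V))^[x.2] (B.coeff (n - x.1 + x.2))) := rfl

theorem BddBy.mul {A B : PDO V} {M L : ℤ} (hA : A.BddBy M) (hB : B.BddBy L) :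
    (A * B).BddBy (M + L) := fun n hn => mulCoeff_eq_zero hA hB n hn

theorem D_add (k : ℕ) (a b : V) : (Differential.deriv (R := V))^[k] (a + b) =
    (Differential.deriv (R := V))^[k] a + (Differential.deriv (R := V))^[k] b :=
  iterate_map_add _ k a b

protected theorem add_mul (A B C : PDO V) : (A + B) * C = A * C + B * C := by
  obtain ⟨M, hM⟩ := A.exists_bddBy
  obtain ⟨L, hL⟩ := B.exists_bddBy
  obtain ⟨P, hP⟩ := C.exists_bddBy
  refine ext fun n => ?_
  rw [coeff_add, coeff_mul, coeff_mul, coeff_mul, ← finsum_add_distrib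
    (mulTerm_support_finite hM hP n) (mulTerm_support_finite hL hP n)]
  exact finsum_congr fun x => by rw [coeff_add, add_mul, smul_add]

protected theorem mul_add (A B C : PDO V) : A * (B + C) = A * B + A * C := by
  obtain ⟨M, hM⟩ := A.exists_bddBy
  obtain ⟨L, hL⟩ := B.exists_bddBy
  obtain ⟨P, hP⟩ := C.exists_bddBy
  refine ext fun n => ?_
  rw [coeff_add, coeff_mul, coeff_mul, coeff_mul, ← finsum_add_distrib
    (mulTerm_support_finite hM hL n) (mulTerm_support_finite hM hP n)]
  exact finsum_congr fun x => by rw [coeff_add, D_add, mul_add, smul_add]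

theorem coeff_monomial_mul (m : ℤ) (a : V) (B : PDO V) (n : ℤ) :
    (monomial m a * B).coeff n = ∑ᶠ k : ℕ, Ring.choose m k •
      (a * (Differential.deriv (R := V))^[k] (B.coeff (n - m + k))) := by
  obtain ⟨L, hL⟩ := B.exists_bddBy
  obtain ⟨M, hM⟩ := (monomial m a).exists_bddBy
  rw [coeff_mul, finsum_curry _ (mulTerm_support_finite hM hL n), finsum_eq_single _ m]
  · simp [coeff_monomial]
  · intro i hi
    simp [coeff_monomial, hi]

theorem monTerm_support_finite (m n : ℤ) (a : V) (B : PDO V) :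
    (Function.support fun k : ℕ => Ring.choose m k •
      (a * (Differential.deriv (R := V))^[k] (B.coeff (n - m + k)))).Finite := by
  obtain ⟨L, hL⟩ := B.exists_bddBy
  refine (Finset.range (L - n + m + 1).toNat).finite_toSet.subset fun k hk => ?_
  by_contra h
  refine hk ?_
  have : B.coeff (n - m + k) = 0 := hL _ (by simp at h; omega)
  simp only [this, D_zero, mul_zero, smul_zero]

theorem coeff_C_mul (a : V) (B : PDO V) (n : ℤ) :
    (monomial 0 a * B).coeff n = a * B.coeff n := by
  rw [coeff_monomial_mul, finsum_eq_single _ 0]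
  · simp
  · intro k hk
    rw [Ring.choose_zero_pos _ (Nat.pos_of_ne_zero hk), zero_smul]

theorem coeff_d_mul (B : PDO V) (n : ℤ) :
    (monomial 1 1 * B).coeff n = B.coeff (n - 1) + (B.coeff n)′ := by
  rw [coeff_monomial_mul, finsum_eq_sum_of_support_subset (s := Finset.range 2)]
  · simp [Finset.sum_range_succ]
  · intro k hk
    by_contra h
    refine hk ?_
    have h2 : 1 < k := by simpa using h
    have : Ring.choose (1 : ℤ) k = 0 := by
      have := Ring.choose_natCast (R := ℤ) 1 k
      rw [Nat.choose_eq_zero_of_lt h2] at this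
      simpa using this
    simp only [this, zero_smul]

protected theorem one_mul (A : PDO V) : 1 * A = A :=
  ext fun n => by rw [show (1 : PDO V) = monomial 0 1 from rfl, coeff_C_mul, one_mul]

protected theorem mul_one (A : PDO V) : A * 1 = A := by
  refine ext fun n => ?_
  rw [coeff_mul, finsum_eq_single _ (n, 0)]
  · simp [show (1 : PDO V) = monomial 0 1 from rfl, coeff_monomial]
  · rintro ⟨i, k⟩ h
    simp only [show (1 : PDO V) = monomial 0 1 from rfl, coeff_monomial]
    split_ifs with h'
    · rcases k with _ | k
      · have hi : i = n := by push_cast at h'; omega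
        exact absurd (by rw [hi]) h
      · rw [Function.iterate_succ_apply, Derivation.map_one_eq_zero, D_zero, mul_zero, smul_zero]
    · rw [D_zero, mul_zero, smul_zero]

def mulL (A : PDO V) : PDO V →+ PDO V := AddMonoidHom.mk' (fun B => A * B) (PDO.mul_add A)
def mulR (B : PDO V) : PDO V →+ PDO V :=
  AddMonoidHom.mk' (fun A => A * B) (fun A A' => PDO.add_mul A A' B)

theorem assoc_of_monomial (A C : PDO V)
    (h : ∀ m b, (A * monomial m b) * C = A * (monomial m b * C)) (B : PDO V) :
    (A * B) * C = A * (B * C) := by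
  obtain ⟨M, hM⟩ := A.exists_bddBy
  obtain ⟨P, hP⟩ := C.exists_bddBy
  refine addHom_ext ((mulR C).comp (mulL A)) ((mulL A).comp (mulR C)) ⟨M + P, ?_⟩ ⟨M + P, ?_⟩ h B
  · intro B K hB n hn
    exact ((hM.mul hB).mul hP) n (by omega)
  · intro B K hB n hn
    exact (hM.mul (hB.mul hP)) n (by omega)

theorem d_mul_monomial (m : ℤ) (b : V) :
    monomial 1 1 * monomial m b = monomial (m + 1) b + monomial m b′ := by
  refine ext fun n => ?_
  rw [coeff_d_mul, coeff_add]
  simp only [coeff_monomial]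
  congr 1
  · exact if_congr (by omega) rfl rfl
  · split_ifs <;> simp

theorem d_mul_assoc (B C : PDO V) :
    (monomial 1 1 * B) * C = monomial 1 1 * (B * C) := by
  refine assoc_of_monomial _ _ (fun m b => ?_) B
  refine ext fun n => ?_
  rw [d_mul_monomial, PDO.add_mul, coeff_add, coeff_d_mul]
  simp only [coeff_monomial_mul]
  set D := Differential.deriv (R := V) with hD
  -- pass to finite sums
  obtain ⟨L, hL⟩ := C.exists_bddBy
  have key : ∀ (i j : ℤ) (a : V) (T : ℕ), L - j + i < T →
      ∑ᶠ k : ℕ, Ring.choose i k • (a * D^[k] (C.coeff (j - i + k))) =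
      ∑ k ∈ Finset.range T, Ring.choose i k • (a * D^[k] (C.coeff (j - i + k))) := by
    intro i j a T hT
    refine finsum_eq_sum_of_support_subset _ fun k hk => ?_
    by_contra h
    refine hk ?_
    have : C.coeff (j - i + k) = 0 := hL _ (by simp at h; omega)
    simp only [this, hD, D_zero, mul_zero, smul_zero]
  obtain ⟨T, hT⟩ : ∃ T : ℕ, L - n + m + 2 < T := ⟨(L - n + m + 3).toNat, by omega⟩
  rw [key (m + 1) n b (T + 1) (by push_cast; omega), key m n _ T (by omega),
    key m (n - 1) b (T + 1) (by push_cast; omega), key m n b T (by omega), map_sum]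
  simp only [map_zsmul, Derivation.leibniz, smul_eq_mul, smul_add, Finset.sum_add_distrib]
  rw [Finset.sum_range_succ' _ T, Finset.sum_range_succ' _ T]
  simp only [Ring.choose_succ_succ, add_smul, Finset.sum_add_distrib]
  have e1 : ∀ k : ℕ, n - (m + 1) + ((k + 1 : ℕ) : ℤ) = n - m + k := by intro k; push_cast; ring
  have e2 : ∀ k : ℕ, n - 1 - m + ((k + 1 : ℕ) : ℤ) = n - m + k := by intro k; push_cast; ring
  have e3 : n - (m + 1) + ((0 : ℕ) : ℤ) = n - 1 - m + ((0 : ℕ) : ℤ) := by ring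
  simp only [e1, e2, e3, Ring.choose_zero_right, Function.iterate_succ_apply']
  have e4 : ∀ k : ℕ, D^[k] (C.coeff (n - m + k)) * D b = D b * D^[k] (C.coeff (n - m + k)) :=
    fun k => mul_comm _ _
  simp only [e4]
  abel

theorem d_mul_injective {B B' : PDO V}
    (h : (monomial 1 1 : PDO V) * B = monomial 1 1 * B') : B = B' := by
  obtain ⟨M, hM⟩ := (B - B').exists_bddBy
  have h0 : ∀ n, (B - B').coeff (n - 1) = -((B - B').coeff n)′ := by
    intro n
    have := congrArg (fun A => coeff A n) h
    simp only [coeff_d_mul] at this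
    simp only [coeff_sub, map_sub]
    linear_combination this
  have h1 : ∀ k : ℕ, (B - B').coeff (M + 1 - k) = 0 := by
    intro k
    induction k with
    | zero => exact hM _ (by simp)
    | succ k ih =>
      have := h0 (M + 1 - k)
      rw [ih, map_zero, neg_zero] at this
      rw [← this]; congr 1; push_cast; ring
  refine ext fun n => sub_eq_zero.mp ?_
  rw [← coeff_sub]
  by_cases hn : M < n
  · exact hM n hn
  · have := h1 (M + 1 - n).toNat
    rwa [show M + 1 - ((M + 1 - n).toNat : ℤ) = n by omega] at this

theorem d_mul_dpow (m : ℤ) :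
    (monomial 1 1 : PDO V) * monomial m 1 = monomial (m + 1) 1 := by
  rw [d_mul_monomial, Derivation.map_one_eq_zero]
  refine ext fun n => ?_
  simp [coeff_monomial]

theorem dpow_mul_assoc (m : ℤ) (B C : PDO V) :
    (monomial m 1 * B) * C = monomial m 1 * (B * C) := by
  induction m with
  | zero => exact (congrArg (· * C) (PDO.one_mul B)).trans (PDO.one_mul (B * C)).symm
  | succ i ih => rw [← d_mul_dpow, d_mul_assoc, d_mul_assoc, ih, ← d_mul_assoc]
  | pred i ih =>
    apply d_mul_injective
    rw [← d_mul_assoc, ← d_mul_assoc, ← d_mul_assoc, d_mul_dpow, sub_add_cancel, ih]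

theorem C_mul_assoc (a : V) (B C : PDO V) :
    (monomial 0 a * B) * C = monomial 0 a * (B * C) := by
  obtain ⟨M, hM⟩ := B.exists_bddBy
  obtain ⟨P, hP⟩ := C.exists_bddBy
  refine ext fun n => ?_
  rw [coeff_C_mul, coeff_mul, coeff_mul, ← AddMonoidHom.coe_mulLeft,
    AddMonoidHom.map_finsum _ (mulTerm_support_finite hM hP n)]
  exact finsum_congr fun x => by
    rw [coeff_C_mul, AddMonoidHom.coe_mulLeft, mul_assoc, mul_smul_comm]

theorem C_mul_dpow (m : ℤ) (a : V) : monomial m a = monomial 0 a * monomial m 1 := by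
  refine ext fun n => ?_
  rw [coeff_C_mul]; simp [coeff_monomial]

protected theorem mul_assoc (A B C : PDO V) : A * B * C = A * (B * C) := by
  obtain ⟨M, hM⟩ := B.exists_bddBy
  obtain ⟨P, hP⟩ := C.exists_bddBy
  refine addHom_ext ((mulR C).comp (mulR B)) (mulR (B * C)) ⟨M + P, ?_⟩ ⟨M + P, ?_⟩ ?_ A
  · intro A K hA n hn
    exact ((hA.mul hM).mul hP) n (by omega)
  · intro A K hA n hn
    exact (hA.mul (hM.mul hP)) n (by omega)
  · intro m a
    change monomial m a * B * C = monomial m a * (B * C)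
    rw [C_mul_dpow, C_mul_assoc, C_mul_assoc, C_mul_assoc, dpow_mul_assoc]

/-- `V((∂⁻¹))` is an associative unital (noncommutative) ring under composition. -/
instance : Ring (PDO V) :=
  { (inferInstance : AddCommGroup (PDO V)), (inferInstance : Mul (PDO V)),
    (inferInstance : One (PDO V)) with
    zero_mul := fun A => (mulR A).map_zero
    mul_zero := fun A => (mulL A).map_zero
    left_distrib := PDO.mul_add
    right_distrib := PDO.add_mul
    mul_assoc := PDO.mul_assoc
    one_mul := PDO.one_mul
    mul_one := PDO.mul_one }

end PDO

/-- The algebra of differential polynomials over `F` in the indeterminates `uᵢ`, `i : ι`: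
the polynomial ring in the variables `uᵢ⁽ⁿ⁾ = X (i, n)`. -/
abbrev DiffPoly (F ι : Type*) [CommRing F] : Type _ := MvPolynomial (ι × ℕ) F

namespace DiffPoly

variable {F : Type*} [CommRing F] {ι : Type*}

/-- The derivation `∂`, with `∂ uᵢ⁽ⁿ⁾ = uᵢ⁽ⁿ⁺¹⁾` and `∂ c = 0` for `c : F`. -/
instance : Differential (DiffPoly F ι) where
  deriv := (MvPolynomial.mkDerivation F fun v : ι × ℕ =>
    (MvPolynomial.X (v.1, v.2 + 1) : DiffPoly F ι)).restrictScalars ℤ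

/-- The operator `λ + ∂` on `V[λ]`, with `∂` acting on the coefficients
(`Polynomial.X` is `λ`). -/
def lamD (P : Polynomial (DiffPoly F ι)) : Polynomial (DiffPoly F ι) :=
  Polynomial.X * P + Differential.mapCoeffs P

/-- The bracket `{g_λ uⱼ} = ∑_{i,m} {uᵢ _{λ+∂} uⱼ}_→ (-λ-∂)ᵐ (∂g/∂uᵢ⁽ᵐ⁾)`, given the brackets
`G i j = {uᵢ_λ uⱼ}` of the generators; the arrow means that in `∑ cₖ (λ+∂)ᵏ` the `∂` acts to
the right. -/
def rightBracket (G : ι → ι → Polynomial (DiffPoly F ι)) (g : DiffPoly F ι) (j : ι) :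
    Polynomial (DiffPoly F ι) :=
  ∑ v ∈ g.vars, (G v.1 j).sum fun k c => Polynomial.C c *
    lamD^[k] ((fun P => -lamD P)^[v.2] (Polynomial.C (MvPolynomial.pderiv v g)))

/-- The `λ`-bracket on differential polynomials with `{uᵢ_λ uⱼ} = G i j`, extended to all
differential polynomials by sesquilinearity and the Leibniz rules (the master formula):
`{g_λ h} = ∑ (∂h/∂uⱼ⁽ⁿ⁾) (λ+∂)ⁿ {uᵢ _{λ+∂} uⱼ}_→ (-λ-∂)ᵐ (∂g/∂uᵢ⁽ᵐ⁾)`.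
`lambdaBracket G g h` is `{g_λ h}`, a derivation in `h`. -/
def lambdaBracket (G : ι → ι → Polynomial (DiffPoly F ι)) (g : DiffPoly F ι) :
    Derivation F (DiffPoly F ι) (Polynomial (DiffPoly F ι)) :=
  MvPolynomial.mkDerivation F fun v => lamD^[v.2] (rightBracket G g v.1)

end DiffPoly

/-- The boxes `(i, h)` of the pyramid of `p`. The column `h = 1, …, pᵢ` is stored as `h - 1`. -/
abbrev Box {r : ℕ} (p : Fin r → ℕ) : Type := Σ i : Fin r, Fin (p i)

namespace WAlg

variable {F : Type*} [Field F] {r : ℕ} (p : Fin r → ℕ)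

variable (F) in
/-- The nilpotent `f`, i.e. `f e_{(i,h)} = e_{(i,h+1)}` for `h < pᵢ` and `f e_{(i,pᵢ)} = 0`. -/
def nilp : Matrix (Box p) (Box p) F :=
  Matrix.of fun a b => if a.1 = b.1 ∧ (a.2 : ℕ) = (b.2 : ℕ) + 1 then 1 else 0

/-- `pᵢ + 1 - 2h`, twice the eigenvalue of `x` on `e_{(i,h)}`. -/
def xdeg (a : Box p) : ℤ := (p a.1 : ℤ) + 1 - 2 * ((a.2 : ℤ) + 1)

variable (F) in
/-- The diagonal matrix `x`, with eigenvalue `(pᵢ + 1 - 2h)/2` on `e_{(i,h)}`. -/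
def xmat : Matrix (Box p) (Box p) F := Matrix.diagonal fun a => (xdeg p a : F) / 2

variable (F) in
/-- The eigenspace `𝔤_{m/2} = {a | [x, a] = (m/2) a}` of `ad x` on `𝔤 = 𝔤𝔩_N`. -/
def gr (m : ℤ) : Submodule F (Matrix (Box p) (Box p) F) where
  carrier := {a | ⁅xmat F p, a⁆ = ((m : F) / 2) • a}
  zero_mem' := by
    change ⁅xmat F p, 0⁆ = _
    rw [Ring.lie_def]; simp
  add_mem' := by
    intro a b (ha : ⁅xmat F p, a⁆ = _) (hb : ⁅xmat F p, b⁆ = _)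
    change ⁅xmat F p, a + b⁆ = _
    rw [smul_add, ← ha, ← hb, Ring.lie_def, Ring.lie_def, Ring.lie_def, mul_add, add_mul]
    abel
  smul_mem' := by
    intro c a (ha : ⁅xmat F p, a⁆ = _)
    change ⁅xmat F p, c • a⁆ = _
    rw [smul_comm, ← ha, Ring.lie_def, Ring.lie_def, mul_smul_comm, smul_mul_assoc, smul_sub]

variable (F) in
/-- The subspace `𝔤_{≥ 1/2} = ⨁_{k ≥ 1/2} 𝔤_k`. -/
def grPos : Submodule F (Matrix (Box p) (Box p) F) := ⨆ m : ℤ, ⨆ _ : 1 ≤ m, gr F p m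

/-- The elementary matrix `E_{ab}` is homogeneous of degree `(xdeg a - xdeg b)/2`. -/
theorem single_mem_gr (a b : Box p) :
    Matrix.single a b (1 : F) ∈ gr F p (xdeg p a - xdeg p b) := by
  change ⁅xmat F p, Matrix.single a b (1 : F)⁆ = _
  ext c e
  simp only [Ring.lie_def, xmat, Matrix.sub_apply, Matrix.diagonal_mul, Matrix.mul_diagonal,
    Matrix.smul_apply, Matrix.single_apply, smul_eq_mul]
  split_ifs with h
  · obtain ⟨rfl, rfl⟩ := h
    push_cast; ring
  · simp

variable (F) in
/-- `𝒱(𝔤)`, the differential polynomials over `𝔤 = 𝔤𝔩_N`, in the basis of elementary matrices: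
the variable `q_{ab} = X ((a, b), 0)` is `E_{ab}` viewed as an element of `𝒱(𝔤)`. -/
abbrev VAll : Type _ := DiffPoly F (Box p × Box p)

/-- The elementary matrices `E_{ab}` of degree at most `1/2`, a basis of `𝔤_{≤ 1/2}`. -/
abbrev LowIdx : Type := {e : Box p × Box p // xdeg p e.1 - xdeg p e.2 ≤ 1}

variable (F) in
/-- `𝒱(𝔤_{≤ 1/2})`, the differential polynomials over `𝔤_{≤ 1/2}`. -/
abbrev VLow : Type _ := DiffPoly F (LowIdx p)

variable {p}

/-- The inclusion `𝒱(𝔤_{≤ 1/2}) ⊆ 𝒱(𝔤)`. -/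
def incl : VLow F p →ₐ[F] VAll F p :=
  MvPolynomial.rename fun v : LowIdx p × ℕ => ((v.1 : Box p × Box p), v.2)

/-- The inclusion `𝔤 ⊆ 𝒱(𝔤)`. -/
def ofMat (a : Matrix (Box p) (Box p) F) : VAll F p :=
  ∑ e : Box p × Box p, MvPolynomial.C (a e.1 e.2) * MvPolynomial.X (e, 0)

/-- `{a_λ b}_ε = [a, b] + tr(ab) λ + ε tr(S [a, b])` for elementary matrices `a`, `b`. -/
def genBracket (S : Matrix (Box p) (Box p) F) (ε : F) (e e' : Box p × Box p) :
    Polynomial (VAll F p) :=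
  let a : Matrix (Box p) (Box p) F := Matrix.single e.1 e.2 1
  let b : Matrix (Box p) (Box p) F := Matrix.single e'.1 e'.2 1
  Polynomial.C (ofMat ⁅a, b⁆)
    + Polynomial.C (MvPolynomial.C (Matrix.trace (a * b))) * Polynomial.X
    + Polynomial.C (MvPolynomial.C (ε * Matrix.trace (S * ⁅a, b⁆)))

/-- The `λ`-bracket `{·_λ ·}_ε` of the affine Poisson vertex algebra `𝒱_ε(𝔤, S)`. -/
def affBracket (S : Matrix (Box p) (Box p) F) (ε : F) (g : VAll F p) :
    Derivation F (VAll F p) (Polynomial (VAll F p)) :=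
  DiffPoly.lambdaBracket (genBracket S ε) g

/-- The differential algebra homomorphism `ρ : 𝒱(𝔤) → 𝒱(𝔤_{≤ 1/2})` with
`ρ(a) = π_{≤ 1/2}(a) + tr(f a)` for `a ∈ 𝔤`. -/
def rho : VAll F p →ₐ[F] VLow F p :=
  MvPolynomial.aeval fun v : (Box p × Box p) × ℕ =>
    (Differential.deriv (R := VLow F p))^[v.2]
      ((if h : xdeg p v.1.1 - xdeg p v.1.2 ≤ 1 then MvPolynomial.X (⟨v.1, h⟩, 0) else 0)
        + MvPolynomial.C (Matrix.trace (nilp F p * Matrix.single v.1.1 v.1.2 1)))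

/-- `ρ{a_λ w}_ε` for `a ∈ 𝔤` and `w ∈ 𝒱(𝔤_{≤ 1/2})`, with `ρ` acting on the coefficients of
the powers of `λ`. -/
def rhoBracket (S : Matrix (Box p) (Box p) F) (ε : F) (a : Matrix (Box p) (Box p) F)
    (w : VLow F p) : Polynomial (VLow F p) :=
  Polynomial.map (rho : VAll F p →ₐ[F] VLow F p).toRingHom (affBracket S ε (ofMat a) (incl w))

/-- The algebra `𝒲 = {w ∈ 𝒱(𝔤_{≤ 1/2}) | ρ{a_λ w}_ε = 0 for all a ∈ 𝔤_{≥ 1/2}}`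
underlying the classical affine `W`-algebra `𝒲_ε(𝔤, f, S)`. -/
def W (S : Matrix (Box p) (Box p) F) (ε : F) : Subalgebra F (VLow F p) where
  carrier := {w | ∀ a ∈ grPos F p, rhoBracket S ε a w = 0}
  mul_mem' := by
    intro u w hu hw a ha
    have hu := hu a ha
    have hw := hw a ha
    unfold rhoBracket at *
    rw [map_mul, Derivation.leibniz, Polynomial.map_add, Polynomial.smul_eq_C_mul,
      Polynomial.smul_eq_C_mul, Polynomial.map_mul, Polynomial.map_mul, hu, hw, mul_zero,
      mul_zero, add_zero]
  add_mem' := by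
    intro u w hu hw a ha
    have hu := hu a ha
    have hw := hw a ha
    unfold rhoBracket at *
    rw [map_add, map_add, Polynomial.map_add, hu, hw, add_zero]
  algebraMap_mem' := by
    intro c a _
    unfold rhoBracket
    rw [AlgHom.commutes, Derivation.map_algebraMap, Polynomial.map_zero]

/-- The matrix differential operator `𝟙_N ∂ + ρ(Q)`, where `Q` has entry `q_{ba}` in position
`(a, b)`. -/
def opA : Matrix (Box p) (Box p) (PDO (VLow F p)) :=
  Matrix.of fun a b => (if a = b then PDO.monomial 1 1 else 0)
    + PDO.monomial 0 (rho (MvPolynomial.X ((b, a), 0)))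

/-- The indices `1, …, r₁` of the rows of maximal length `p₁`. -/
abbrev TopRow [NeZero r] (p : Fin r → ℕ) : Type := {i : Fin r // p i = p 0}

/-- `I₁ = ∑_{i ≤ r₁} E_{(i1),i}`, an `N × r₁` matrix. -/
def I₁ (R : Type*) [Zero R] [One R] [NeZero r] (p : Fin r → ℕ) : Matrix (Box p) (TopRow p) R :=
  Matrix.of fun a i => if a.1 = i.1 ∧ (a.2 : ℕ) + 1 = 1 then 1 else 0

/-- `J₁ = ∑_{i ≤ r₁} E_{i,(i p₁)}`, an `r₁ × N` matrix. -/
def J₁ (R : Type*) [Zero R] [One R] [NeZero r] (p : Fin r → ℕ) : Matrix (TopRow p) (Box p) R :=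
  Matrix.of fun i a => if a.1 = i.1 ∧ (a.2 : ℕ) + 1 = p 0 then 1 else 0

variable (F) in
/-- `L₁⁻¹(∂) = J₁ (𝟙_N ∂ + ρ(Q))⁻¹ I₁`, the inverse being taken in the ring
`Mat_{N×N} 𝒱(𝔤_{≤ 1/2})((∂⁻¹))`. -/
def L₁inv [NeZero r] (p : Fin r → ℕ) : Matrix (TopRow p) (TopRow p) (PDO (VLow F p)) :=
  J₁ (PDO (VLow F p)) p * Ring.inverse (opA : Matrix (Box p) (Box p) (PDO (VLow F p)))
    * I₁ (PDO (VLow F p)) p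

end WAlg

end

/-!
Write `A = 𝟙∂ + ρ(Q)`. The order-one coefficient of `A` is the identity, so `A` has the inverse
`∑_{k ≥ 0} Pₖ ∂⁻ᵏ⁻¹` with `P₀ = 𝟙` and `Pₖ₊₁ = -(Pₖ′ + ρ(Q) Pₖ)`: it is a right inverse by
construction, and a left inverse because `A` can be cancelled on the left
(`PDO.dPlus_mul_dPlusInv`, `PDO.dPlusInv_mul_dPlus`).

Fix `a ∈ 𝔤_{≥ 1/2}` and let `δ w = ρ{a_λ w}_ε`. As `ρ` restricts to the identity on
`𝒱(𝔤_{≤ 1/2})`, this is a derivation into `𝒱(𝔤_{≤ 1/2})[λ]` (`WAlg.rhoDerivation`), and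
`δ(w′) = (λ + ∂) δ w`. In `𝒱(𝔤)` the generators satisfy `{a_λ Q}_ε = [Q, a] + λ a + ε [S, a]`
(`WAlg.affBracket_X`). Since `S` lies in the top degree `d` of `𝔤`, both `S a` and `a S` vanish,
which removes all dependence on `S` and `ε`; a degree count on the entries of `Q` that `ρ` turns
into constants then gives `δ ρ(Q) = [ρ(Q), a] + λ a` (`WAlg.rhoBracket_rhoQ`).

Hence `a` acts on `A` by an infinitesimal gauge transformation, and on the symbol of the inverse by
`δ A⁻¹(z) = A⁻¹(z + λ) a - a A⁻¹(z)`. Coefficientwise this says that each `δ Pₖ` has the form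
`M a - a Pₖ`, which follows from the recursion by induction on `k`
(`DiffPoly.exists_map_invCoeff`). The boxes `(i, p₁)` selected by `J₁` have the smallest
`x`-eigenvalue, and the boxes `(j, 1)` selected by `I₁` the largest, so `J₁ a = 0 = a I₁` and
`δ (J₁ A⁻¹(z) I₁) = 0` (`WAlg.rhoBracket_L₁inv`).
-/

open scoped Differential

noncomputable section

/-! ### The inverse of a first-order matrix differential operator -/

namespace PDO

section Coefficients
variable {V : Type*} [AddCommGroup V] {ι : Type*}

theorem coeff_sum {κ : Type*} (s : Finset κ) (A : κ → PDO V) (n : ℤ) :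
    (∑ i ∈ s, A i).coeff n = ∑ i ∈ s, (A i).coeff n :=
  map_sum (⟨⟨fun B : PDO V => B.coeff n, rfl⟩, fun _ _ => rfl⟩ : PDO V →+ V) _ _

/-- The matrix of coefficients of `∂ⁿ` of a matrix pseudodifferential operator. -/
def matCoeff (A : Matrix ι ι (PDO V)) (n : ℤ) : Matrix ι ι V := A.map fun B => B.coeff n

theorem matCoeff_ext {A B : Matrix ι ι (PDO V)} (h : ∀ n, matCoeff A n = matCoeff B n) :
    A = B :=
  Matrix.ext fun i j => PDO.ext fun n => congrFun (congrFun (h n) i) j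

end Coefficients

section MatrixOperators
variable {V : Type*} [CommRing V] [Differential V]
variable {ι : Type*} [DecidableEq ι]

/-- The first-order matrix differential operator `𝟙∂ + Q`. -/
def dPlus (Q : Matrix ι ι V) : Matrix ι ι (PDO V) :=
  Matrix.of fun a b => (if a = b then monomial 1 1 else 0) + monomial 0 (Q a b)

theorem matCoeff_one (n : ℤ) :
    matCoeff (1 : Matrix ι ι (PDO V)) n = if n = 0 then 1 else 0 := by
  ext i j
  simp only [matCoeff, Matrix.map_apply, Matrix.one_apply]
  split_ifs with h1 h2 h2
  · subst h1 h2; simp [show (1 : PDO V) = monomial 0 1 from rfl, coeff_monomial]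
  · simp [show (1 : PDO V) = monomial 0 1 from rfl, coeff_monomial, h2]
  · simp [h1]
  · simp

variable [Fintype ι]

theorem matCoeff_dPlus_mul (Q : Matrix ι ι V) (A : Matrix ι ι (PDO V)) (n : ℤ) :
    matCoeff (dPlus Q * A) n =
      matCoeff A (n - 1) + ((matCoeff A n).map (·′) + Q * matCoeff A n) := by
  ext i j
  simp only [matCoeff, dPlus, Matrix.map_apply, Matrix.mul_apply, Matrix.of_apply, coeff_sum,
    add_mul, coeff_add, coeff_C_mul, Finset.sum_add_distrib, Matrix.add_apply, ite_mul, zero_mul]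
  rw [← coeff_sum, Finset.sum_ite_eq, if_pos (Finset.mem_univ _), coeff_d_mul, add_assoc]

/-- The matrices `P₀ = 𝟙`, `Pₖ₊₁ = -(Pₖ′ + Q Pₖ)`: the coefficient of `∂⁻ᵏ⁻¹` in the inverse
of `𝟙∂ + Q` is `Pₖ`. -/
def invCoeff (Q : Matrix ι ι V) : ℕ → Matrix ι ι V
  | 0 => 1
  | k + 1 => -((invCoeff Q k).map (·′) + Q * invCoeff Q k)

/-- The operator `∑_{k ≥ 0} Pₖ ∂⁻ᵏ⁻¹`, the inverse of `𝟙∂ + Q`. -/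
def dPlusInv (Q : Matrix ι ι V) : Matrix ι ι (PDO V) :=
  Matrix.of fun i j => ⟨fun n => if n < 0 then invCoeff Q (-1 - n).toNat i j else 0, -1,
    fun _ hn => if_neg (by omega)⟩

theorem matCoeff_dPlusInv (Q : Matrix ι ι V) (n : ℤ) :
    matCoeff (dPlusInv Q) n = if n < 0 then invCoeff Q (-1 - n).toNat else 0 := by
  ext i j
  change (if n < 0 then invCoeff Q (-1 - n).toNat i j else 0) = _
  split_ifs <;> rfl

theorem dPlus_mul_dPlusInv (Q : Matrix ι ι V) : dPlus Q * dPlusInv Q = 1 := by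
  refine matCoeff_ext fun n => ?_
  rw [matCoeff_dPlus_mul, matCoeff_one, matCoeff_dPlusInv, matCoeff_dPlusInv]
  have hz : (0 : Matrix ι ι V).map (·′) = 0 := by ext; simp
  rcases lt_trichotomy n 0 with h | rfl | h
  · rw [if_pos h, if_pos (by omega), if_neg h.ne,
      show (-1 - (n - 1)).toNat = (-1 - n).toNat + 1 by omega, invCoeff, neg_add_cancel]
  · simp [invCoeff, hz]
  · rw [if_neg (by omega), if_neg (by omega), if_neg h.ne', hz]; simp

/-- The leading coefficient of `𝟙∂ + Q` is invertible, so the operator is left cancellable. -/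
theorem eq_zero_of_dPlus_mul_eq_zero (Q : Matrix ι ι V) {A : Matrix ι ι (PDO V)}
    (h : dPlus Q * A = 0) : A = 0 := by
  choose b hb using fun x : ι × ι => (A x.1 x.2).exists_bddBy
  obtain ⟨M, hM⟩ := (Set.finite_range b).bddAbove
  have htop : ∀ n, M < n → matCoeff A n = 0 := fun n hn =>
    Matrix.ext fun i j => hb (i, j) n (lt_of_le_of_lt (hM ⟨(i, j), rfl⟩) hn)
  have hz : (0 : Matrix ι ι V).map (·′) = 0 := by ext; simp
  -- Descending induction: the coefficient of `∂ⁿ⁻¹` is determined by that of `∂ⁿ`.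
  have hdown : ∀ k : ℕ, matCoeff A (M + 1 - k) = 0 := by
    intro k
    induction k with
    | zero => exact htop _ (by simp)
    | succ k ih =>
      have := matCoeff_dPlus_mul Q A (M + 1 - k)
      rw [h, ih, hz, mul_zero, add_zero, add_zero] at this
      rw [show M + 1 - ((k + 1 : ℕ) : ℤ) = M + 1 - k - 1 by push_cast; ring, ← this]
      rfl
  refine matCoeff_ext fun n => ?_
  change _ = (0 : Matrix ι ι V)
  by_cases hn : M < n
  · exact htop n hn
  · have := hdown (M + 1 - n).toNat
    rwa [show M + 1 - ((M + 1 - n).toNat : ℤ) = n by omega] at this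

theorem dPlusInv_mul_dPlus (Q : Matrix ι ι V) : dPlusInv Q * dPlus Q = 1 := by
  refine sub_eq_zero.mp (eq_zero_of_dPlus_mul_eq_zero Q ?_)
  rw [mul_sub, ← mul_assoc, dPlus_mul_dPlusInv, one_mul, mul_one, sub_self]

/-- `𝟙∂ + Q` as a unit of the ring of matrix pseudodifferential operators. -/
def dPlusUnit (Q : Matrix ι ι V) : (Matrix ι ι (PDO V))ˣ :=
  ⟨dPlus Q, dPlusInv Q, dPlus_mul_dPlusInv Q, dPlusInv_mul_dPlus Q⟩

theorem inverse_dPlus (Q : Matrix ι ι V) : Ring.inverse (dPlus Q) = dPlusInv Q :=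
  Ring.inverse_unit (dPlusUnit Q)

end MatrixOperators

end PDO

/-! ### Homomorphisms and sesquilinearity on differential polynomials -/

namespace DiffPoly
variable {F : Type*} [CommRing F] {ι : Type*}

theorem deriv_X (v : ι × ℕ) :
    (MvPolynomial.X v : DiffPoly F ι)′ = MvPolynomial.X (v.1, v.2 + 1) :=
  MvPolynomial.mkDerivation_X F _ v

theorem deriv_C (c : F) : (MvPolynomial.C c : DiffPoly F ι)′ = 0 :=
  MvPolynomial.derivation_C (MvPolynomial.mkDerivation F _) c

/-- An algebra homomorphism that commutes with `∂` on the variables commutes with `∂`. -/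
theorem algHom_deriv {κ : Type*} (φ : DiffPoly F ι →ₐ[F] DiffPoly F κ)
    (h : ∀ v, φ (MvPolynomial.X v)′ = (φ (MvPolynomial.X v))′) (u : DiffPoly F ι) :
    φ u′ = (φ u)′ := by
  induction u using MvPolynomial.induction_on with
  | C c => rw [deriv_C, map_zero, ← MvPolynomial.algebraMap_eq, AlgHom.commutes,
      MvPolynomial.algebraMap_eq, deriv_C]
  | add u v hu hv => simp only [map_add, hu, hv]
  | mul_X u v hu =>
    simp only [map_mul, map_add, Derivation.leibniz, smul_eq_mul, hu, h]

theorem lamD_add (P P' : Polynomial (DiffPoly F ι)) : lamD (P + P') = lamD P + lamD P' := by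
  simp only [lamD, mul_add, map_add]; ring

theorem lamD_C_mul (u : DiffPoly F ι) (P : Polynomial (DiffPoly F ι)) :
    lamD (Polynomial.C u * P) = Polynomial.C u * lamD P + Polynomial.C u′ * P := by
  simp only [lamD, Derivation.leibniz, smul_eq_mul, Differential.mapCoeffs_C]; ring

theorem lamD_const_mul (c : F) (P : Polynomial (DiffPoly F ι)) :
    lamD (Polynomial.C (MvPolynomial.C c) * P) =
      Polynomial.C (MvPolynomial.C c) * lamD P := by
  rw [lamD_C_mul, deriv_C, map_zero, zero_mul, add_zero]

theorem lamD_C (u : DiffPoly F ι) :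
    lamD (Polynomial.C u) = Polynomial.X * Polynomial.C u + Polynomial.C u′ := by
  rw [lamD, Differential.mapCoeffs_C]

theorem lamD_zero : lamD (0 : Polynomial (DiffPoly F ι)) = 0 := by
  simp [lamD]

/-- `λ + ∂` as an additive map. -/
def lamDHom : Polynomial (DiffPoly F ι) →+ Polynomial (DiffPoly F ι) :=
  AddMonoidHom.mk' lamD lamD_add

theorem lamD_map {κ : Type*} (φ : DiffPoly F ι →ₐ[F] DiffPoly F κ)
    (h : ∀ u, φ u′ = (φ u)′) (P : Polynomial (DiffPoly F ι)) :
    (lamD P).map φ.toRingHom = lamD (P.map φ.toRingHom) := by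
  ext n : 1
  simp only [lamD, Polynomial.map_add, Polynomial.map_mul, Polynomial.map_X, Polynomial.coeff_add,
    Polynomial.coeff_map, Differential.coeff_mapCoeffs]
  cases n <;> simp [h]

/-- On constants `λ + ∂` is multiplication by `λ`. -/
theorem lamD_iterate_const (c : F) (k : ℕ) :
    (lamD (F := F) (ι := ι))^[k] (Polynomial.C (MvPolynomial.C c)) =
      Polynomial.C (MvPolynomial.C c) * Polynomial.X ^ k := by
  induction k with
  | zero => simp
  | succ k ih =>
    rw [Function.iterate_succ_apply', ih, lamD_const_mul, pow_succ]
    congr 1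
    simp [lamD]
    ring

/-- Sesquilinearity in the second argument: `{g_λ h′} = (λ + ∂){g_λ h}`. -/
theorem lambdaBracket_deriv (G : ι → ι → Polynomial (DiffPoly F ι)) (g h : DiffPoly F ι) :
    lambdaBracket G g h′ = lamD (lambdaBracket G g h) := by
  have hX : ∀ v : ι × ℕ, lambdaBracket G g (MvPolynomial.X v) =
      lamD^[v.2] (rightBracket G g v.1) := fun v => MvPolynomial.mkDerivation_X F _ v
  induction h using MvPolynomial.induction_on with
  | C c =>
    rw [deriv_C, map_zero, ← MvPolynomial.algebraMap_eq, Derivation.map_algebraMap, lamD_zero]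
  | add u v hu hv => rw [map_add, map_add, map_add, hu, hv, lamD_add]
  | mul_X u v hu =>
    simp only [map_add, Derivation.leibniz, smul_eq_mul, hu, Polynomial.smul_eq_C_mul, lamD_add,
      lamD_C_mul]
    rw [deriv_X, hX, hX, Function.iterate_succ_apply']
    ring

end DiffPoly

/-! ### Gauge transformations of the inverse operator -/

namespace DiffPoly
variable {F : Type*} [CommRing F] {ι κ : Type*} [Fintype κ]

/-- The identity behind the inductive step of `exists_map_invCoeff`, with `L = (λ + ∂) M` and
`dP = ∂ P`. -/
theorem gauge_step_identity {R κ : Type*} [CommRing R] [Fintype κ]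
    (x : R) (a q L M P dP : Matrix κ κ R) :
    -(L * a - a * (x • P + dP) + (q * (M * a - a * P) + (q * a - a * q + x • a) * P)) =
      -(L + q * M) * a - a * -(dP + q * P) := by
  simp only [mul_add, add_mul, mul_sub, sub_mul, neg_mul, mul_neg, Matrix.mul_smul,
    Matrix.smul_mul, mul_assoc]
  abel

theorem map_gauge_apply {A K : Type*} [CommRing A] [CommRing K] (φ : A →+* K)
    (Q a : Matrix κ κ A) (x : K) (b c : κ) :
    φ ((∑ e, a e c * Q b e) - ∑ e, a b e * Q e c) + φ (a b c) * x =
      (Q.map φ * a.map φ - a.map φ * Q.map φ + x • a.map φ) b c := by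
  simp only [Matrix.add_apply, Matrix.sub_apply, Matrix.mul_apply, Matrix.map_apply,
    Matrix.smul_apply, smul_eq_mul, map_sub, map_sum, map_mul, mul_comm]

variable [DecidableEq κ]

/-- If `{a_λ ·} = δ` acts on `Q` by the gauge transformation `[Q, a] + λ a`, it acts on each
coefficient of `(𝟙∂ + Q)⁻¹` by `P ↦ M a - a P` for some `M`: the symbol of the inverse satisfies
`δ A⁻¹(z) = A⁻¹(z + λ) a - a A⁻¹(z)`. -/
theorem exists_map_invCoeff
    (δ : Derivation F (DiffPoly F ι) (Polynomial (DiffPoly F ι)))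
    (hδ : ∀ u, δ u′ = lamD (δ u)) (Q : Matrix κ κ (DiffPoly F ι)) (a : Matrix κ κ F)
    (hQ : Q.map δ = Q.map Polynomial.C * a.map (fun c => Polynomial.C (MvPolynomial.C c))
      - a.map (fun c => Polynomial.C (MvPolynomial.C c)) * Q.map Polynomial.C
      + (Polynomial.X : Polynomial (DiffPoly F ι)) •
        a.map (fun c => Polynomial.C (MvPolynomial.C c))) (k : ℕ) :
    ∃ M, (PDO.invCoeff Q k).map δ = M * a.map (fun c => Polynomial.C (MvPolynomial.C c))
      - a.map (fun c => Polynomial.C (MvPolynomial.C c)) *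
        (PDO.invCoeff Q k).map Polynomial.C := by
  have lam_sub : ∀ P P' : Matrix κ κ (Polynomial (DiffPoly F ι)),
      (P - P').map lamD = P.map lamD - P'.map lamD := fun P P' =>
    Matrix.ext fun i j => map_sub (lamDHom (F := F) (ι := ι)) _ _
  have lam_mul_const : ∀ P : Matrix κ κ (Polynomial (DiffPoly F ι)),
      (P * a.map (fun c => Polynomial.C (MvPolynomial.C c))).map lamD =
        P.map lamD * a.map (fun c => Polynomial.C (MvPolynomial.C c)) := by
    intro P
    ext1 i j
    simp only [Matrix.map_apply, Matrix.mul_apply]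
    refine (map_sum (lamDHom (F := F) (ι := ι)) _ _).trans (Finset.sum_congr rfl fun l _ => ?_)
    change lamD _ = _
    rw [mul_comm, lamD_const_mul, mul_comm]
  have lam_const_mul : ∀ P : Matrix κ κ (Polynomial (DiffPoly F ι)),
      (a.map (fun c => Polynomial.C (MvPolynomial.C c)) * P).map lamD =
        a.map (fun c => Polynomial.C (MvPolynomial.C c)) * P.map lamD := by
    intro P
    ext1 i j
    simp only [Matrix.map_apply, Matrix.mul_apply]
    refine (map_sum (lamDHom (F := F) (ι := ι)) _ _).trans (Finset.sum_congr rfl fun l _ => ?_)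
    exact lamD_const_mul _ _
  have lam_C : ∀ P : Matrix κ κ (DiffPoly F ι), (P.map Polynomial.C).map lamD =
      (Polynomial.X : Polynomial (DiffPoly F ι)) • P.map Polynomial.C +
        (P.map (·′)).map Polynomial.C := fun P =>
    Matrix.ext fun i j => lamD_C _
  have map_step : ∀ P : Matrix κ κ (DiffPoly F ι), (-(P.map (·′) + Q * P)).map δ =
      -((P.map δ).map lamD + (Q.map Polynomial.C * P.map δ + Q.map δ * P.map Polynomial.C)) := by
    intro P
    ext1 i j
    simp only [Matrix.map_apply, Matrix.neg_apply, Matrix.add_apply, Matrix.mul_apply, map_neg,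
      map_add, map_sum, hδ, Derivation.leibniz, Polynomial.smul_eq_C_mul, Finset.sum_add_distrib]
    simp only [mul_comm]
  have map_C_step : ∀ P : Matrix κ κ (DiffPoly F ι),
      (-(P.map (·′) + Q * P)).map Polynomial.C =
      -((P.map (·′)).map Polynomial.C + Q.map Polynomial.C * P.map Polynomial.C) := by
    intro P
    ext1 i j
    simp only [Matrix.map_apply, Matrix.neg_apply, Matrix.add_apply, Matrix.mul_apply, map_neg,
      map_add, map_sum, map_mul]
  induction k with
  | zero =>
    refine ⟨1, ?_⟩
    ext1 i j
    by_cases h : i = j <;> simp [PDO.invCoeff, h]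
  | succ k ih =>
    obtain ⟨M, hM⟩ := ih
    refine ⟨-(M.map lamD + Q.map Polynomial.C * M), ?_⟩
    rw [PDO.invCoeff, map_step, map_C_step, hM, hQ, lam_sub, lam_mul_const, lam_const_mul, lam_C]
    exact gauge_step_identity _ _ _ _ _ _ _

/-- An entry of `(𝟙∂ + Q)⁻¹` in a row where `a` vanishes and a column where `a` vanishes is
invariant under the gauge transformation `a`. -/
theorem map_invCoeff_eq_zero
    (δ : Derivation F (DiffPoly F ι) (Polynomial (DiffPoly F ι)))
    (hδ : ∀ u, δ u′ = lamD (δ u)) (Q : Matrix κ κ (DiffPoly F ι)) (a : Matrix κ κ F)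
    (hQ : ∀ b c, δ (Q b c) =
      Polynomial.C ((∑ e, MvPolynomial.C (a e c) * Q b e) - ∑ e, MvPolynomial.C (a b e) * Q e c)
        + Polynomial.C (MvPolynomial.C (a b c)) * Polynomial.X)
    (k : ℕ) {b c : κ} (hb : ∀ e, a b e = 0) (hc : ∀ e, a e c = 0) :
    δ (PDO.invCoeff Q k b c) = 0 := by
  obtain ⟨M, hM⟩ := exists_map_invCoeff δ hδ Q a (Matrix.ext fun b c =>
    (hQ b c).trans (map_gauge_apply Polynomial.C Q (a.map MvPolynomial.C) Polynomial.X b c)) k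
  refine (congrFun (congrFun hM b) c).trans ?_
  simp [Matrix.mul_apply, hb, hc]

end DiffPoly

/-! ### Degrees in `𝔤𝔩_N` -/

namespace WAlg
variable {F : Type*} [Field F] {r : ℕ} {p : Fin r → ℕ}

theorem gr_apply_eq_zero [CharZero F] {m : ℤ} {a : Matrix (Box p) (Box p) F}
    (ha : a ∈ gr F p m) {b c : Box p} (h : xdeg p b - xdeg p c ≠ m) : a b c = 0 := by
  have h1 : ⁅xmat F p, a⁆ b c = (((m : F) / 2) • a) b c := congrFun (congrFun ha b) c
  simp only [Ring.lie_def, xmat, Matrix.sub_apply, Matrix.diagonal_mul, Matrix.mul_diagonal,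
    Matrix.smul_apply, smul_eq_mul] at h1
  have h2 : ((xdeg p b - xdeg p c - m : ℤ) : F) * a b c = 0 := by
    push_cast
    linear_combination 2 * h1
  exact (mul_eq_zero.mp h2).resolve_left (Int.cast_ne_zero.mpr (sub_ne_zero.mpr h))

theorem grPos_apply_eq_zero [CharZero F] {a : Matrix (Box p) (Box p) F}
    (ha : a ∈ grPos F p) {b c : Box p} (h : xdeg p b - xdeg p c ≤ 0) : a b c = 0 := by
  let U : Submodule F (Matrix (Box p) (Box p) F) :=
    { carrier := {a | a b c = 0}
      zero_mem' := rfl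
      add_mem' := fun {x y} (hx : x b c = 0) (hy : y b c = 0) =>
        show x b c + y b c = 0 by rw [hx, hy, add_zero]
      smul_mem' := fun t x (hx : x b c = 0) => show t * x b c = 0 by rw [hx, mul_zero] }
  have hU : grPos F p ≤ U :=
    iSup_le fun m => iSup_le fun hm x hx => gr_apply_eq_zero hx (by omega)
  exact hU ha

theorem nilp_apply_eq_zero {b c : Box p} (h : xdeg p b - xdeg p c ≠ 2) : nilp F p c b = 0 := by
  refine if_neg fun ⟨h1, h2⟩ => h ?_
  simp only [xdeg, h1, h2]
  push_cast; ring

/-- Since `|xdeg| ≤ p₁ - 1`, nothing in `𝔤` has degree larger than `d = p₁ - 1`. -/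
theorem xdeg_sub_xdeg_le [NeZero r] (hp : Antitone p) (b c : Box p) :
    xdeg p b - xdeg p c ≤ 2 * ((p 0 : ℤ) - 1) := by
  have hb := hp (Fin.zero_le b.1)
  have hc := hp (Fin.zero_le c.1)
  have := b.2.isLt
  have := c.2.isLt
  simp only [xdeg]
  omega

/-- `[S, a] = 0` for degree reasons, as `S` has the top degree `d`; in fact both products vanish. -/
theorem mul_eq_zero_of_mem_gr [CharZero F] [NeZero r] (hp : Antitone p)
    {S a : Matrix (Box p) (Box p) F} (hS : S ∈ gr F p (2 * ((p 0 : ℤ) - 1)))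
    (ha : a ∈ grPos F p) : S * a = 0 ∧ a * S = 0 := by
  constructor <;> ext b c <;> refine Finset.sum_eq_zero fun e _ => ?_
  · change S b e * a e c = 0
    by_cases h : xdeg p b - xdeg p e = 2 * ((p 0 : ℤ) - 1)
    · have := xdeg_sub_xdeg_le hp b c
      rw [grPos_apply_eq_zero ha (b := e) (c := c) (by omega), mul_zero]
    · rw [gr_apply_eq_zero hS h, zero_mul]
  · change a b e * S e c = 0
    by_cases h : xdeg p e - xdeg p c = 2 * ((p 0 : ℤ) - 1)
    · have := xdeg_sub_xdeg_le hp b c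
      rw [grPos_apply_eq_zero ha (b := b) (c := e) (by omega), zero_mul]
    · rw [gr_apply_eq_zero hS h, mul_zero]

/-! ### The affine bracket with an element of `𝔤` -/

theorem ofMat_single (b c : Box p) :
    ofMat (Matrix.single b c (1 : F)) = MvPolynomial.X ((b, c), 0) := by
  rw [ofMat, Finset.sum_eq_single (b, c)]
  · simp
  · rintro ⟨b', c'⟩ - h
    have : ¬(b = b' ∧ c = c') := fun h' => h (by rw [h'.1, h'.2])
    simp [this]
  · simp

theorem ofMat_sub (a b : Matrix (Box p) (Box p) F) : ofMat (a - b) = ofMat a - ofMat b := by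
  simp [ofMat, sub_mul, Finset.sum_sub_distrib]

theorem ofMat_single_mul_single (b c d e : Box p) :
    ofMat (Matrix.single b c (1 : F) * Matrix.single d e 1) =
      if c = d then MvPolynomial.X ((b, e), 0) else 0 := by
  split_ifs with h
  · subst h; rw [Matrix.single_mul_single_same, one_mul, ofMat_single]
  · rw [Matrix.single_mul_single_of_ne _ _ _ _ h]; simp [ofMat]

theorem trace_mul_single (S : Matrix (Box p) (Box p) F) (b c : Box p) :
    Matrix.trace (S * Matrix.single b c 1) = S c b := by
  simp [Matrix.trace_mul_single]

/-- The bracket of two elementary matrices, from `E_{bc} E_{de} = δ_{cd} E_{be}`. -/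
theorem genBracket_apply (S : Matrix (Box p) (Box p) F) (ε : F) (b c d e : Box p) :
    genBracket S ε (b, c) (d, e) =
      Polynomial.C ((if c = d then MvPolynomial.X ((b, e), 0) else 0)
          - (if b = e then MvPolynomial.X ((d, c), 0) else 0))
        + Polynomial.C (MvPolynomial.C (if c = d then if b = e then 1 else 0 else 0))
          * Polynomial.X
        + Polynomial.C (MvPolynomial.C (ε * ((if c = d then S e b else 0)
          - (if b = e then S c d else 0)))) := by
  simp only [genBracket, Ring.lie_def, ofMat_sub, ofMat_single_mul_single, mul_sub,
    Matrix.trace_sub]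
  have h1 : ∀ b c d e : Box p, Matrix.trace
      (S * (Matrix.single b c (1 : F) * Matrix.single d e 1)) = if c = d then S e b else 0 := by
    intro b c d e
    split_ifs with h
    · subst h; rw [Matrix.single_mul_single_same, one_mul, trace_mul_single]
    · rw [Matrix.single_mul_single_of_ne _ _ _ _ h]; simp
  rw [h1, h1, trace_mul_single]
  simp only [Matrix.single_apply, eq_comm (a := e)]
  congr 4
  split_ifs <;> simp_all

/-- An element of `𝔤` involves no derivatives of the generators and its partial derivatives are
constants, on which `∂` acts as zero; so the master formula is linear in it. -/
theorem rightBracket_ofMat (G : Box p × Box p → Box p × Box p → Polynomial (VAll F p))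
    (a : Matrix (Box p) (Box p) F) (e : Box p × Box p) :
    DiffPoly.rightBracket G (ofMat a) e =
      ∑ e' : Box p × Box p, Polynomial.C (MvPolynomial.C (a e'.1 e'.2)) * G e' e := by
  classical
  have hd : ∀ e' : Box p × Box p,
      MvPolynomial.pderiv (e', 0) (ofMat a) = MvPolynomial.C (a e'.1 e'.2) := by
    intro e'
    rw [ofMat, map_sum, Finset.sum_eq_single e']
    · simp
    · intro e'' _ h
      rw [MvPolynomial.pderiv_C_mul, MvPolynomial.pderiv_X_of_ne (by simpa using h), mul_zero]
    · simp
  have hvars : (ofMat a).vars ⊆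
      Finset.univ.image fun e' : Box p × Box p => ((e', 0) : (Box p × Box p) × ℕ) := by
    refine (MvPolynomial.vars_sum_subset _ _).trans (Finset.biUnion_subset.mpr fun e' _ => ?_)
    refine (MvPolynomial.vars_mul _ _).trans ?_
    rw [MvPolynomial.vars_C, MvPolynomial.vars_X, Finset.empty_union]
    simp
  rw [DiffPoly.rightBracket, Finset.sum_subset hvars,
    Finset.sum_image fun _ _ _ _ h => (Prod.ext_iff.mp h).1]
  · refine Finset.sum_congr rfl fun e' _ => ?_
    simp only [hd, Function.iterate_zero, id, DiffPoly.lamD_iterate_const]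
    conv_rhs => rw [← Polynomial.sum_C_mul_X_pow_eq (G e' e), Polynomial.sum, Finset.mul_sum]
    exact Finset.sum_congr rfl fun k _ => by ring
  · intro v hv hv'
    obtain ⟨e', -, rfl⟩ := Finset.mem_image.mp hv
    rw [MvPolynomial.pderiv_eq_zero_of_notMem_vars hv']
    refine Finset.sum_eq_zero fun k _ => ?_
    simp only [map_zero, Function.iterate_zero, id]
    rw [Function.iterate_fixed DiffPoly.lamD_zero, mul_zero]

/-- `{a_λ Q}_ε = [Q, a] + λ a + ε [S, a]`, entry by entry, the entry of `Q` in position `(b, c)`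
being `E_{cb}`. -/
theorem affBracket_X (S : Matrix (Box p) (Box p) F) (ε : F) (a : Matrix (Box p) (Box p) F)
    (b c : Box p) :
    affBracket S ε (ofMat a) (MvPolynomial.X ((c, b), 0)) =
      Polynomial.C ((∑ e, MvPolynomial.C (a e c) * MvPolynomial.X ((e, b), 0))
          - ∑ e, MvPolynomial.C (a b e) * MvPolynomial.X ((c, e), 0))
        + Polynomial.C (MvPolynomial.C (a b c)) * Polynomial.X
        + Polynomial.C (MvPolynomial.C (ε * ((S * a) b c - (a * S) b c))) := by
  have h : affBracket S ε (ofMat a) (MvPolynomial.X ((c, b), 0)) =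
      DiffPoly.rightBracket (genBracket S ε) (ofMat a) (c, b) :=
    MvPolynomial.mkDerivation_X F _ _
  rw [h, rightBracket_ofMat, Fintype.sum_prod_type]
  simp only [genBracket_apply, mul_add, Finset.sum_add_distrib, ← mul_assoc, ← map_mul,
    ← Finset.sum_mul, ← map_sum, mul_sub, Finset.sum_sub_distrib, mul_ite, mul_one, mul_zero]
  have h1 : ∀ (R : Type _) [AddCommMonoid R] (t : Box p → Box p → R),
      (∑ x, ∑ y, if y = c then t x y else 0) = ∑ x, t x c := fun R _ t => by simp
  have h2 : ∀ (R : Type _) [AddCommMonoid R] (t : Box p → Box p → R),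
      (∑ x, ∑ y, if x = b then t x y else 0) = ∑ y, t b y := fun R _ t => by
    rw [Finset.sum_comm]; simp
  rw [h1, h2, h1, h2, h1, Finset.sum_ite_eq', if_pos (Finset.mem_univ b), Matrix.mul_apply,
    Matrix.mul_apply, Finset.mul_sum, Finset.mul_sum]
  congr 6
  · exact funext fun e => by ring
  · exact funext fun e => by ring

/-! ### The homomorphism `ρ` and the derivation `ρ{a_λ ·}` -/

theorem rho_X (e : Box p × Box p) :
    rho (MvPolynomial.X (e, 0) : VAll F p) =
      (if h : xdeg p e.1 - xdeg p e.2 ≤ 1 then MvPolynomial.X (⟨e, h⟩, 0) else 0)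
        + MvPolynomial.C (nilp F p e.2 e.1) := by
  rw [rho, MvPolynomial.aeval_X, trace_mul_single]; rfl

/-- The shift by `tr(f a)` does not affect degrees at most `1/2`, as `f` pairs only with degree
`1`. -/
theorem rho_X_of_le {e : Box p × Box p} (h : xdeg p e.1 - xdeg p e.2 ≤ 1) :
    rho (MvPolynomial.X (e, 0) : VAll F p) = MvPolynomial.X (⟨e, h⟩, 0) := by
  rw [rho_X, dif_pos h, nilp_apply_eq_zero (by omega), map_zero, add_zero]

theorem rho_X_of_lt {e : Box p × Box p} (h : 1 < xdeg p e.1 - xdeg p e.2) :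
    rho (MvPolynomial.X (e, 0) : VAll F p) = MvPolynomial.C (nilp F p e.2 e.1) := by
  rw [rho_X, dif_neg (by omega), zero_add]

theorem rho_deriv (u : VAll F p) : rho u′ = (rho u)′ := by
  refine DiffPoly.algHom_deriv rho (fun v => ?_) u
  rw [DiffPoly.deriv_X, rho, MvPolynomial.aeval_X, MvPolynomial.aeval_X,
    Function.iterate_succ_apply']

theorem incl_X (v : LowIdx p × ℕ) :
    incl (MvPolynomial.X v : VLow F p) = MvPolynomial.X ((v.1 : Box p × Box p), v.2) :=
  MvPolynomial.rename_X _ _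

theorem incl_deriv (u : VLow F p) : incl u′ = (incl u)′ := by
  refine DiffPoly.algHom_deriv incl (fun v => ?_) u
  rw [DiffPoly.deriv_X, incl_X, incl_X, DiffPoly.deriv_X]

theorem rho_incl (u : VLow F p) : rho (incl u) = u := by
  suffices h : (rho.comp incl : VLow F p →ₐ[F] VLow F p) = AlgHom.id F _ from
    DFunLike.congr_fun h u
  refine MvPolynomial.algHom_ext fun v => ?_
  rw [AlgHom.comp_apply, AlgHom.id_apply, incl_X]
  obtain ⟨e, n⟩ := v
  induction n with
  | zero => exact rho_X_of_le e.2
  | succ n ih =>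
    have := rho_deriv (MvPolynomial.X ((e : Box p × Box p), n) : VAll F p)
    rwa [ih, DiffPoly.deriv_X, DiffPoly.deriv_X] at this

theorem rhoBracket_add (S : Matrix (Box p) (Box p) F) (ε : F)
    (a : Matrix (Box p) (Box p) F) (u v : VLow F p) :
    rhoBracket S ε a (u + v) = rhoBracket S ε a u + rhoBracket S ε a v := by
  rw [rhoBracket, map_add, map_add, Polynomial.map_add]; rfl

/-- The Leibniz rule for `ρ{a_λ ·}_ε`, as `ρ` is the identity on `𝒱(𝔤_{≤ 1/2})`. -/
theorem rhoBracket_mul (S : Matrix (Box p) (Box p) F) (ε : F)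
    (a : Matrix (Box p) (Box p) F) (u v : VLow F p) :
    rhoBracket S ε a (u * v) =
      Polynomial.C u * rhoBracket S ε a v + Polynomial.C v * rhoBracket S ε a u := by
  have h : ∀ w : VLow F p,
      (rho : VAll F p →ₐ[F] VLow F p).toRingHom (incl w) = w := rho_incl
  rw [rhoBracket, map_mul, Derivation.leibniz, Polynomial.map_add, Polynomial.smul_eq_C_mul,
    Polynomial.smul_eq_C_mul, Polynomial.map_mul, Polynomial.map_mul, Polynomial.map_C,
    Polynomial.map_C, h, h]
  rfl

theorem rhoBracket_C (S : Matrix (Box p) (Box p) F) (ε : F)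
    (a : Matrix (Box p) (Box p) F) (t : F) :
    rhoBracket S ε a (MvPolynomial.C t) = 0 := by
  rw [rhoBracket, ← MvPolynomial.algebraMap_eq, AlgHom.commutes, Derivation.map_algebraMap,
    Polynomial.map_zero]

/-- `w ↦ ρ{a_λ w}_ε` as a derivation `𝒱(𝔤_{≤ 1/2}) → 𝒱(𝔤_{≤ 1/2})[λ]`. -/
def rhoDerivation (S : Matrix (Box p) (Box p) F) (ε : F) (a : Matrix (Box p) (Box p) F) :
    Derivation F (VLow F p) (Polynomial (VLow F p)) :=
  Derivation.mk'
    { toFun := rhoBracket S ε a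
      map_add' := rhoBracket_add S ε a
      map_smul' := fun c u => by
        rw [MvPolynomial.smul_eq_C_mul, rhoBracket_mul, rhoBracket_C, mul_zero, add_zero,
          RingHom.id_apply, ← Polynomial.smul_eq_C_mul, ← MvPolynomial.algebraMap_eq,
          algebraMap_smul] }
    fun u v => by
      rw [Polynomial.smul_eq_C_mul, Polynomial.smul_eq_C_mul]
      exact rhoBracket_mul S ε a u v

theorem rhoBracket_deriv (S : Matrix (Box p) (Box p) F) (ε : F)
    (a : Matrix (Box p) (Box p) F) (u : VLow F p) :
    rhoBracket S ε a u′ = DiffPoly.lamD (rhoBracket S ε a u) := by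
  rw [rhoBracket, incl_deriv, affBracket, DiffPoly.lambdaBracket_deriv,
    DiffPoly.lamD_map _ rho_deriv]
  rfl

/-! ### Invariance of the coefficients of `L₁⁻¹` -/

/-- The matrix `ρ(Q)`. -/
def rhoQ : Matrix (Box p) (Box p) (VLow F p) :=
  Matrix.of fun b c => rho (MvPolynomial.X ((c, b), 0))

theorem opA_eq : (opA : Matrix (Box p) (Box p) (PDO (VLow F p))) = PDO.dPlus rhoQ := rfl

theorem map_gauge_symbol {A B κ : Type*} [CommRing A] [CommRing B] [Fintype κ] (φ : A →+* B)
    (x y x' y' : κ → A) (s t : A) :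
    (Polynomial.C ((∑ e, x e * y e) - ∑ e, x' e * y' e) + Polynomial.C s * Polynomial.X
        + Polynomial.C t).map φ =
      Polynomial.C ((∑ e, φ (x e) * φ (y e)) - ∑ e, φ (x' e) * φ (y' e))
        + Polynomial.C (φ s) * Polynomial.X + Polynomial.C (φ t) := by
  rw [Polynomial.map_add, Polynomial.map_add, Polynomial.map_mul, Polynomial.map_C,
    Polynomial.map_C, Polynomial.map_C, Polynomial.map_X]
  simp only [map_sub, map_sum, map_mul]

/-- `ρ{a_λ ρ(Q)} = [ρ(Q), a] + λ a` for `a ∈ 𝔤_{≥ 1/2}`. For the entries on which `ρ` is constant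
(those in `𝔤_{≥ 1}`) the left side vanishes, and so does the right side, by degree. -/
theorem rhoBracket_rhoQ [CharZero F] [NeZero r] (hp : Antitone p)
    {S a : Matrix (Box p) (Box p) F} (hS : S ∈ gr F p (2 * ((p 0 : ℤ) - 1)))
    (ha : a ∈ grPos F p) (ε : F) (b c : Box p) :
    rhoBracket S ε a (rhoQ b c) =
      Polynomial.C ((∑ e, MvPolynomial.C (a e c) * rhoQ b e)
          - ∑ e, MvPolynomial.C (a b e) * rhoQ e c)
        + Polynomial.C (MvPolynomial.C (a b c)) * Polynomial.X := by
  change rhoBracket S ε a (rho (MvPolynomial.X ((c, b), 0))) = _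
  by_cases h : xdeg p c - xdeg p b ≤ 1
  · have hC : ∀ t : F, (rho : VAll F p →ₐ[F] VLow F p).toRingHom (MvPolynomial.C t) =
        MvPolynomial.C t := fun t => AlgHom.commutes rho t
    have hX : ∀ b c, (rho : VAll F p →ₐ[F] VLow F p).toRingHom
        (MvPolynomial.X ((c, b), 0)) = rhoQ b c := fun _ _ => rfl
    obtain ⟨h1, h2⟩ := mul_eq_zero_of_mem_gr hp hS ha
    rw [rho_X_of_le (e := (c, b)) h, rhoBracket, incl_X, affBracket_X, h1, h2]
    refine (map_gauge_symbol _ _ _ _ _ _ _).trans ?_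
    rw [Matrix.zero_apply, sub_zero, mul_zero, map_zero, map_zero, map_zero, add_zero, hC]
    simp only [hC, hX]
  · -- `f` has degree `-1`, so `tr(f E_{cb})` survives only in degree exactly `1`.
    have hQ : ∀ b c : Box p, 2 < xdeg p c - xdeg p b → (rhoQ b c : VLow F p) = 0 := by
      intro b c h
      refine (rho_X_of_lt (e := (c, b)) (by dsimp only; omega)).trans ?_
      rw [nilp_apply_eq_zero (by dsimp only; omega), map_zero]
    rw [rho_X_of_lt (e := (c, b)) (by dsimp only; omega), rhoBracket_C,
      grPos_apply_eq_zero ha (b := b) (c := c) (by omega), Finset.sum_eq_zero,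
      Finset.sum_eq_zero]
    · simp
    · intro e _
      by_cases he : xdeg p b - xdeg p e ≤ 0
      · rw [grPos_apply_eq_zero ha he, map_zero, zero_mul]
      · rw [hQ _ _ (by omega), mul_zero]
    · intro e _
      by_cases he : xdeg p e - xdeg p c ≤ 0
      · rw [grPos_apply_eq_zero ha he, map_zero, zero_mul]
      · rw [hQ _ _ (by omega), mul_zero]

theorem rhoBracket_invCoeff [CharZero F] [NeZero r] (hp : Antitone p)
    {S a : Matrix (Box p) (Box p) F} (hS : S ∈ gr F p (2 * ((p 0 : ℤ) - 1)))
    (ha : a ∈ grPos F p) (ε : F) (k : ℕ) {b c : Box p} (hb : ∀ e, a b e = 0)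
    (hc : ∀ e, a e c = 0) : rhoBracket S ε a (PDO.invCoeff rhoQ k b c) = 0 := by
  exact DiffPoly.map_invCoeff_eq_zero (rhoDerivation S ε a) (rhoBracket_deriv S ε a) rhoQ a
    (rhoBracket_rhoQ hp hS ha ε) k hb hc

/-- The entries of `L₁⁻¹` are those entries of the inverse of `𝟙∂ + ρ(Q)` whose row is the last
box and whose column is the first box of a row of maximal length. -/
theorem L₁inv_apply [NeZero r] (hpos : ∀ i, 0 < p i) (i j : TopRow p) :
    L₁inv F p i j = (PDO.dPlusInv rhoQ : Matrix (Box p) (Box p) (PDO (VLow F p)))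
      ⟨i.1, ⟨p i.1 - 1, Nat.sub_lt (hpos _) one_pos⟩⟩ ⟨j.1, ⟨0, hpos _⟩⟩ := by
  rw [L₁inv, opA_eq, PDO.inverse_dPlus, Matrix.mul_apply,
    Finset.sum_eq_single ⟨j.1, ⟨0, hpos _⟩⟩, Matrix.mul_apply,
    Finset.sum_eq_single ⟨i.1, ⟨p i.1 - 1, Nat.sub_lt (hpos _) one_pos⟩⟩]
  · have := hpos i.1
    have := i.2
    simp only [J₁, I₁, Matrix.of_apply]
    rw [if_pos ⟨trivial, by omega⟩, if_pos ⟨trivial, trivial⟩, one_mul, mul_one]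
  · rintro ⟨i', h⟩ - hne
    simp only [J₁, Matrix.of_apply]
    rw [if_neg, zero_mul]
    rintro ⟨h1, h2⟩
    obtain rfl : i' = i.1 := h1
    have := i.2
    exact hne (Sigma.ext rfl (heq_of_eq (Fin.ext (by dsimp only; omega))))
  · simp
  · rintro ⟨j', h⟩ - hne
    simp only [I₁, Matrix.of_apply]
    rw [if_neg, mul_zero]
    rintro ⟨h1, h2⟩
    obtain rfl : j' = j.1 := h1
    exact hne (Sigma.ext rfl (heq_of_eq (Fin.ext (by dsimp only; omega))))
  · simp

/-- The coefficients of `L₁⁻¹` are invariant: the rows of `J₁` have the lowest and the columns of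
`I₁` the highest `x`-eigenvalue, so that `J₁ a = 0 = a I₁` for `a ∈ 𝔤_{≥ 1/2}`. -/
theorem rhoBracket_L₁inv [CharZero F] [NeZero r] (hp : Antitone p) (hpos : ∀ i, 0 < p i)
    {S a : Matrix (Box p) (Box p) F} (hS : S ∈ gr F p (2 * ((p 0 : ℤ) - 1)))
    (ha : a ∈ grPos F p) (ε : F) (i j : TopRow p) (n : ℤ) :
    rhoBracket S ε a ((L₁inv F p i j).coeff n) = 0 := by
  have hcoeff := congrFun (congrFun
    (PDO.matCoeff_dPlusInv (rhoQ : Matrix (Box p) (Box p) (VLow F p)) n)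
    ⟨i.1, ⟨p i.1 - 1, Nat.sub_lt (hpos _) one_pos⟩⟩) ⟨j.1, ⟨0, hpos _⟩⟩
  rw [L₁inv_apply hpos]
  refine (congrArg (rhoBracket S ε a) hcoeff).trans ?_
  split_ifs
  · refine rhoBracket_invCoeff hp hS ha ε _ (fun e => grPos_apply_eq_zero ha ?_)
      (fun e => grPos_apply_eq_zero ha ?_)
    all_goals
      have := hp (Fin.zero_le e.1)
      have := e.2.isLt
      have := i.2
      have := j.2
      have := hpos i.1
      simp only [xdeg]
      omega
  · exact (rhoDerivation S ε a).map_zero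

end WAlg

end

theorem mainTheorem2 {F : Type*} [Field F] [CharZero F]
    (r : ℕ) [NeZero r] (p : Fin r → ℕ) (hp : Antitone p) (hpos : ∀ i, 0 < p i) :
    IsUnit (WAlg.opA : Matrix (Box p) (Box p) (PDO (WAlg.VLow F p))) ∧
    (∀ S ∈ WAlg.gr F p (2 * ((p 0 : ℤ) - 1)), ∀ ε : F, ∀ a ∈ WAlg.grPos F p,
      ∀ (i j : WAlg.TopRow p) (n : ℤ),
        WAlg.rhoBracket S ε a ((WAlg.L₁inv F p i j).coeff n) = 0) ∧
    (∀ S ∈ WAlg.gr F p (2 * ((p 0 : ℤ) - 1)), ∀ ε : F,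
      ∀ (i j : WAlg.TopRow p) (n : ℤ), (WAlg.L₁inv F p i j).coeff n ∈ WAlg.W S ε) := by
  exact ⟨(PDO.dPlusUnit WAlg.rhoQ).isUnit,
    fun S hS ε a ha i j n => WAlg.rhoBracket_L₁inv hp hpos hS ha ε i j n,
    fun S hS ε i j n a ha => WAlg.rhoBracket_L₁inv hp hpos hS ha ε i j n⟩
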